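/- For a topological space $X$, let $C_p(X)$ be the space of all continuous real-valued functions on $X$ with the topology of pointwise convergence. A space $Z$ is called Hurewicz if for every sequence $(\mathcal U_n)_{n\in\mathbb N}$ of open covers of $Z$ there are finite subfamilies $\mathcal V_n\subseteq\mathcal U_n$ such that every point of $Z$ belongs to $\bigcup\mathcal V_n$ for all but finitely many $n$. A space $X$ is called projectively Hurewicz if every separable metrizable continuous image of $X$ is Hurewicz. Theorem. Let $X$ and $Y$ be Tychonoff spaces such that $C_p(X)$ and $C_p(Y)$ are homeomorphic. Then $X$ is projectively Hurewicz if and only if $Y$ is projectively Hurewicz. -/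

import Mathlib

universe u v

/-- The space `C_p(X)`: continuous real-valued functions on `X` with the topology of pointwise
convergence, that is, the topology of a subspace of the product `X → ℝ`. -/
abbrev Cp (X : Type*) [TopologicalSpace X] : Type _ := {f : X → ℝ // Continuous f}

/-- `X` is a Hurewicz space: for every sequence of open covers `𝒰 n` of `X` there are finite
subfamilies `𝒱 n ⊆ 𝒰 n` such that every point of `X` lies in `⋃₀ 𝒱 n` for all but finitely
many `n`. -/
def IsHurewicz (X : Type*) [TopologicalSpace X] : Prop :=
  ∀ 𝒰 : ℕ → Set (Set X),
    (∀ n, (∀ U ∈ 𝒰 n, IsOpen U) ∧ ⋃₀ 𝒰 n = Set.univ) →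
    ∃ 𝒱 : ℕ → Set (Set X),
      (∀ n, 𝒱 n ⊆ 𝒰 n ∧ (𝒱 n).Finite) ∧
      ∀ x : X, ∀ᶠ n in Filter.atTop, x ∈ ⋃₀ 𝒱 n

/-- `X` is projectively Hurewicz: every separable metrizable continuous image of `X` is Hurewicz.
(A continuous image of `X` is equinumerous with a quotient of `X`, so images in the universe
of `X` are all images up to homeomorphism.) -/
def IsProjectivelyHurewicz (X : Type u) [TopologicalSpace X] : Prop :=
  ∀ (Z : Type u) [TopologicalSpace Z] [TopologicalSpace.SeparableSpace Z]
    [TopologicalSpace.MetrizableSpace Z] (f : X → Z),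
    Continuous f → Function.Surjective f → IsHurewicz Z

/-!
A space is projectively Hurewicz exactly when every sequence of continuous real functions on it is
eventually dominated, at each point, by one sequence of constants
(`isProjectivelyHurewicz_iff_isSequentiallyDominated`). Equivalently, whenever a continuous map
into a compact metrizable space takes the space into a Gδ-set `G`, there is a σ-compact set between
its image and `G`; `IsSequentiallyDominated.exists_isSigmaCompact` is the form used here.

Let `φ : Cp X ≃ₜ Cp Y`, let `X` have this property, and let `e` map `Y` into a compact metrizable
space `M`, the image missing the closed sets `F m`. For `w ∈ C(M, ℝ)` put
`T w = φ⁻¹ (w ∘ e) - φ⁻¹ 0`. A countable dense set of `w`'s gives, via `min |T w| 1`, a map of `X`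
into a metrizable compactum. Continuity of `φ⁻¹` provides each `x ∈ X` with a finite control set
`B ⊆ e(Y)`: if `w` is small on `B`, then `|T w x| ≤ ε`. Now let control sets range over all of `M`.
The points with a control set of at most `j` points form a closed set, by compactness of `M`. For
`x ∈ X`, control sets of minimal size still lie in `e(Y)`, since points of `M` outside `e(Y)` can be
dropped (`IsPointwiseContinuous.abs_le_of_control`). So, on each of countably many differences of
closed sets, having only control sets that avoid every `F m` is a Gδ-condition that holds at all
points of `X`, and domination yields a σ-compact set `S`, containing the image of `X`, each of whose
points has a finite control set avoiding every `F m`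
(`IsSequentiallyDominated.exists_isSigmaCompact_control`).

Continuity of `φ` provides control sets in the other direction: each `y ∈ Y` has a finite `A ⊆ X`
such that `|w (e y)| ≤ 1` as soon as `T w` is small on `A`. The points `q ∈ M` with such a control
set inside `S` form a σ-compact set containing `e(Y)`. It avoids every `F m`: a function `w` that
vanishes on the control sets of the points of `A` has `T w` small on `A`, hence `|w q| ≤ 1`; by
Urysohn's lemma `q` belongs to one of these control sets. Only finite powers of the σ-compact set `S`
occur, so it does no harm that finite powers of Hurewicz spaces need not be Hurewicz. For suitable
`M` and `F m`, the σ-compact set yields the dominating sequence on `Y`.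
-/

open Set Filter Topology

/-! ### Projective Hurewicz spaces and dominated sequences -/

/-- Every sequence of continuous real functions on `X` is eventually dominated, at each point, by
one sequence of constants. -/
def IsSequentiallyDominated (X : Type*) [TopologicalSpace X] : Prop :=
  ∀ f : ℕ → X → ℝ, (∀ n, Continuous (f n)) →
    ∃ g : ℕ → ℝ, ∀ x, ∀ᶠ n in atTop, |f n x| ≤ g n

theorem IsProjectivelyHurewicz.isSequentiallyDominated {X : Type u} [TopologicalSpace X]
    (h : IsProjectivelyHurewicz X) : IsSequentiallyDominated X := by
  intro f hf
  let F : X → ℕ → ℝ := fun x n => f n x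
  have hF : Continuous F := continuous_pi hf
  -- The image of `X` in `ℕ → ℝ` is lifted to the universe of `X`.
  let Z := ULift.{u} (range F)
  have : SecondCountableTopology Z := Homeomorph.ulift.secondCountableTopology
  have : TopologicalSpace.MetrizableSpace Z := Homeomorph.ulift.isEmbedding.metrizableSpace
  have hZ : IsHurewicz Z := h Z (fun x => ULift.up (rangeFactorization F x))
    (continuous_uliftUp.comp hF.rangeFactorization) (fun z => by
      obtain ⟨⟨_, x, rfl⟩⟩ := z
      exact ⟨x, rfl⟩)
  have hcoord : ∀ n, Continuous fun z : Z => |z.down.1 n| := fun n =>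
    ((continuous_apply n).comp (continuous_subtype_val.comp continuous_uliftDown)).abs
  obtain ⟨𝒱, h𝒱, hx⟩ := hZ (fun n => range fun k : ℕ => {z : Z | |z.down.1 n| < k}) (by
    intro n
    refine ⟨?_, ?_⟩
    · rintro _ ⟨k, rfl⟩
      exact isOpen_lt (hcoord n) continuous_const
    · refine eq_univ_of_forall fun z => ?_
      obtain ⟨k, hk⟩ := exists_nat_gt |z.down.1 n|
      exact ⟨_, ⟨k, rfl⟩, hk⟩)
  have hbound : ∀ n, ∃ c : ℝ, ∀ z ∈ ⋃₀ 𝒱 n, |z.down.1 n| ≤ c := by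
    intro n
    have hB : BddAbove (⋃ V ∈ 𝒱 n, (fun z : Z => |z.down.1 n|) '' V) := by
      refine ((h𝒱 n).2.bddAbove_biUnion).2 fun V hV => ?_
      obtain ⟨k, rfl⟩ := (h𝒱 n).1 hV
      refine ⟨k, ?_⟩
      rintro _ ⟨z, hz, rfl⟩
      exact le_of_lt hz
    obtain ⟨c, hc⟩ := hB
    refine ⟨c, ?_⟩
    rintro z ⟨V, hV, hz⟩
    exact hc (mem_biUnion hV ⟨z, hz, rfl⟩)
  choose g hg using hbound
  exact ⟨g, fun x => (hx (ULift.up (rangeFactorization F x))).mono fun n hn => hg n _ hn⟩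

/-- A countable open cover of a paracompact normal space is controlled by a continuous function
`f`: the members of index at most `f z` already cover `z`. -/
theorem exists_continuous_forall_exists_le {Z : Type*} [TopologicalSpace Z] [NormalSpace Z]
    [ParacompactSpace Z] (U : ℕ → Set Z) (hU : ∀ k, IsOpen (U k)) (hcov : ⋃ k, U k = univ) :
    ∃ f : C(Z, ℝ), ∀ z, ∃ k : ℕ, (k : ℝ) ≤ f z ∧ z ∈ U k := by
  refine exists_continuous_forall_mem_convex_of_local_const
    (t := fun z => {c : ℝ | ∃ k : ℕ, (k : ℝ) ≤ c ∧ z ∈ U k}) ?_ ?_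
  · intro z
    apply OrdConnected.convex
    refine ⟨?_⟩
    rintro a ⟨k, hk, hz⟩ b - c hc
    exact ⟨k, hk.trans hc.1, hz⟩
  · intro z
    obtain ⟨k, hk⟩ := mem_iUnion.1 (hcov.symm ▸ mem_univ z)
    refine ⟨k, ?_⟩
    filter_upwards [(hU k).mem_nhds hk] with y hy
    exact ⟨k, le_rfl, hy⟩

theorem IsSequentiallyDominated.isProjectivelyHurewicz {X : Type u} [TopologicalSpace X]
    (h : IsSequentiallyDominated X) : IsProjectivelyHurewicz X := by
  intro Z _ _ _ p hp hsurj 𝒰 h𝒰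
  let := TopologicalSpace.metrizableSpaceMetric Z
  have : SecondCountableTopology Z := UniformSpace.secondCountable_of_separable Z
  rcases isEmpty_or_nonempty Z with hZ | ⟨⟨z₀⟩⟩
  · exact ⟨fun _ => ∅, fun n => ⟨empty_subset _, finite_empty⟩, fun z => hZ.elim z⟩
  have hU : ∀ n, ∃ U : ℕ → Set Z, (∀ k, U k ∈ 𝒰 n) ∧ ⋃ k, U k = univ := by
    intro n
    obtain ⟨T, hTc, hTs, hT⟩ := TopologicalSpace.isOpen_sUnion_countable (𝒰 n) (h𝒰 n).1
    rw [(h𝒰 n).2] at hT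
    obtain ⟨V, hV, -⟩ : z₀ ∈ ⋃₀ T := hT.symm ▸ mem_univ z₀
    obtain ⟨U, rfl⟩ := hTc.exists_eq_range ⟨V, hV⟩
    exact ⟨U, fun k => hTs ⟨k, rfl⟩, by rw [← hT, sUnion_range]⟩
  choose U hU hcov using hU
  choose f hf using fun n =>
    exists_continuous_forall_exists_le (U n) (fun k => (h𝒰 n).1 _ (hU n k)) (hcov n)
  obtain ⟨g, hg⟩ := h (fun n x => f n (p x)) (fun n => (f n).continuous.comp hp)
  refine ⟨fun n => U n '' {k | k ≤ ⌊g n⌋₊}, fun n => ⟨?_, (finite_le_nat _).image _⟩, ?_⟩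
  · rintro _ ⟨k, -, rfl⟩
    exact hU n k
  · intro z
    obtain ⟨x, rfl⟩ := hsurj z
    filter_upwards [hg x] with n hn
    obtain ⟨k, hk, hz⟩ := hf n (p x)
    exact ⟨_, ⟨k, Nat.le_floor (hk.trans ((le_abs_self _).trans hn)), rfl⟩, hz⟩

theorem isProjectivelyHurewicz_iff_isSequentiallyDominated {X : Type u} [TopologicalSpace X] :
    IsProjectivelyHurewicz X ↔ IsSequentiallyDominated X :=
  ⟨fun h => h.isSequentiallyDominated, fun h => h.isProjectivelyHurewicz⟩

/-! ### σ-compact sets between the image of a space and a Gδ-set -/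

theorem IsSequentiallyDominated.exists_isSigmaCompact_of_isClosed {X K : Type*}
    [TopologicalSpace X] (h : IsSequentiallyDominated X) [TopologicalSpace K] [CompactSpace K]
    [TopologicalSpace.MetrizableSpace K] {e : X → K} (he : Continuous e) {C : Set K}
    (hC : IsClosed C) {E : ℕ → Set K} (hE : ∀ m, IsClosed (E m))
    (hdisj : ∀ x m, e x ∈ C → e x ∉ E m) :
    ∃ S, IsSigmaCompact S ∧ S ⊆ C ∧ (∀ m, Disjoint S (E m)) ∧ ∀ x, e x ∈ C → e x ∈ S := by
  choose g hg hg01 using fun m =>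
    perfectlyNormalSpace_iff_forall_isClosed_preimage_zero.1 inferInstance _ ((hE m).inter hC)
  have hzero : ∀ m p, g m p = 0 ↔ p ∈ E m ∧ p ∈ C := fun m p => by
    rw [← mem_inter_iff, hg m]; rfl
  have hpos : ∀ m x, 0 < g m (e x) := fun m x =>
    lt_of_le_of_ne (hg01 m _).1 fun h0 =>
      hdisj x m ((hzero m _).1 h0.symm).2 ((hzero m _).1 h0.symm).1
  obtain ⟨b, hb⟩ := h (fun m x => (g m (e x))⁻¹)
    (fun m => ((g m).continuous.comp he).inv₀ fun x => (hpos m x).ne')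
  let c : ℕ → ℝ := fun m => (max (b m) 1)⁻¹
  have hc : ∀ m, 0 < c m := fun m => inv_pos.2 (lt_max_of_lt_right one_pos)
  let L : ℕ → Set K := fun t => {p | p ∈ C ∧ ∀ m, min (c m) (1 / (t + 1 : ℝ)) ≤ g m p}
  have hLc : ∀ t, IsCompact (L t) := fun t => by
    have : L t = C ∩ ⋂ m, {p | min (c m) (1 / (t + 1 : ℝ)) ≤ g m p} := by
      ext p
      simp [L]
    rw [this]
    exact (hC.inter (isClosed_iInter fun m =>
      isClosed_le continuous_const (g m).continuous)).isCompact
  refine ⟨⋃ t, L t, isSigmaCompact_iUnion_of_isCompact _ hLc, iUnion_subset fun t p hp => hp.1,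
    fun m => ?_, fun x hx => ?_⟩
  · rw [Set.disjoint_left]
    rintro p hp hpE
    obtain ⟨t, hpC, ht⟩ := mem_iUnion.1 hp
    have h1 := ht m
    rw [(hzero m p).2 ⟨hpE, hpC⟩] at h1
    exact absurd h1 (not_le.2 (lt_min (hc m) Nat.one_div_pos_of_nat))
  · -- The bound holds from some index `N` on; the finitely many earlier values are positive.
    obtain ⟨N, hN⟩ := eventually_atTop.1 (hb x)
    have : ∀ᶠ t : ℕ in atTop, ∀ m ∈ Finset.range N, 1 / (t + 1 : ℝ) < g m (e x) :=
      (Finset.eventually_all _).2 fun m _ =>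
        tendsto_one_div_add_atTop_nhds_zero_nat.eventually_lt_const (hpos m x)
    obtain ⟨t, ht⟩ := this.exists
    refine mem_iUnion.2 ⟨t, hx, fun m => ?_⟩
    rcases lt_or_ge m N with hm | hm
    · exact (min_le_right _ _).trans (ht m (Finset.mem_range.2 hm)).le
    · refine (min_le_left _ _).trans (inv_le_of_inv_le₀ (hpos m x) ?_)
      exact (le_abs_self _).trans ((hN m hm).trans (le_max_left _ _))

theorem IsSequentiallyDominated.exists_isSigmaCompact {X K : Type*}
    [TopologicalSpace X] (h : IsSequentiallyDominated X) [TopologicalSpace K] [CompactSpace K]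
    [TopologicalSpace.MetrizableSpace K] {e : X → K} (he : Continuous e) {C D : Set K}
    (hC : IsClosed C) (hD : IsClosed D) {E : ℕ → Set K} (hE : ∀ m, IsClosed (E m))
    (hdisj : ∀ x m, e x ∈ C → e x ∉ D → e x ∉ E m) :
    ∃ S, IsSigmaCompact S ∧ S ⊆ C ∧ (∀ m, Disjoint S (E m)) ∧
      ∀ x, e x ∈ C → e x ∉ D → e x ∈ S := by
  obtain ⟨g, hg, hg01⟩ :=
    perfectlyNormalSpace_iff_forall_isClosed_preimage_zero.1 inferInstance _ hD
  have hzero : ∀ p, g p = 0 ↔ p ∈ D := fun p => by rw [hg]; rfl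
  choose S hS hSC hSE hSx using fun r : ℕ => h.exists_isSigmaCompact_of_isClosed he
    (hC.inter (isClosed_le continuous_const g.continuous : IsClosed {p | 1 / (r + 1 : ℝ) ≤ g p})) hE
    (fun x m hx => hdisj x m hx.1 fun hxD => absurd (hx.2.trans_eq ((hzero _).2 hxD))
      (not_le.2 Nat.one_div_pos_of_nat))
  refine ⟨⋃ r, S r, isSigmaCompact_iUnion _ hS, iUnion_subset fun r => (hSC r).trans
    inter_subset_left, fun m => disjoint_iUnion_left.2 fun r => hSE r m, fun x hx hxD => ?_⟩
  obtain ⟨r, hr⟩ := exists_nat_one_div_lt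
    (lt_of_le_of_ne (hg01 (e x)).1 fun h0 => hxD ((hzero _).1 h0.symm))
  exact mem_iUnion.2 ⟨r, hSx r x ⟨hx, hr.le⟩⟩

/-! ### Finite control sets -/

theorem isClosed_setOf_forall_imp_le {Z ι κ : Type*} [TopologicalSpace Z] [Finite κ]
    {f : ι → κ → Z → ℝ} {g : ι → Z → ℝ} (hf : ∀ i a, Continuous (f i a))
    (hg : ∀ i, Continuous (g i)) (δ ε : ℝ) :
    IsClosed {z | ∀ i, (∀ a, f i a z < δ) → g i z ≤ ε} := by
  have : {z | ∀ i, (∀ a, f i a z < δ) → g i z ≤ ε} =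
      ⋂ i, ((⋃ a, {z | δ ≤ f i a z}) ∪ {z | g i z ≤ ε}) := by
    ext z
    simp only [mem_ofPred_eq, mem_iInter, mem_union, mem_iUnion]
    refine forall_congr' fun i => ?_
    rw [imp_iff_not_or, not_forall]
    simp only [not_lt]
  rw [this]
  exact isClosed_iInter fun i =>
    (isClosed_iUnion_of_finite fun a => isClosed_le continuous_const (hf i a)).union
      (isClosed_le (hg i) continuous_const)

/-- `T` sends each `w ∈ C(M, ℝ)` to a function on `X` whose values depend continuously on the
values of `w` at the points of `e '' D`, `D ⊆ Y` finite. -/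
def IsPointwiseContinuous {X Y M : Type*} [TopologicalSpace M] (e : Y → M)
    (T : C(M, ℝ) → X → ℝ) : Prop :=
  ∀ x w, ∀ η > 0, ∃ D : Set Y, D.Finite ∧ ∃ θ > 0, ∀ w' : C(M, ℝ),
    (∀ d ∈ D, |w' (e d) - w (e d)| < θ) → |T w' x - T w x| < η

/-- Points outside the range of `e` can be dropped from a control set: `T w x` depends only on
values of `w` on `range e`, and these do not constrain the values of `w` at finitely many
other points. -/
theorem IsPointwiseContinuous.abs_le_of_control {X Y M : Type*} [TopologicalSpace M]
    [CompactSpace M] [T2Space M] {e : Y → M} {T : C(M, ℝ) → X → ℝ}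
    (hT : IsPointwiseContinuous e T) {v : ℕ → C(M, ℝ)} (hv : DenseRange v) {x : X} {B : Set M}
    (hB : B.Finite) {δ ε : ℝ} (hδ : 0 < δ)
    (h : ∀ i, (∀ b ∈ B, |v i b| < δ) → |T (v i) x| ≤ ε) (i : ℕ)
    (hi : ∀ b ∈ B, b ∈ range e → |v i b| < δ) : |T (v i) x| ≤ ε := by
  refine le_of_forall_pos_le_add fun η hη => ?_
  obtain ⟨D, hD, θ, hθ, hDT⟩ := hT x (v i) η hη
  have hfin₀ : (B \ range e).Finite := hB.subset sdiff_subset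
  have hfin₁ : (e '' D ∪ B ∩ range e).Finite := (hD.image e).union (hB.subset inter_subset_left)
  obtain ⟨w, hw0, hw1, -⟩ := exists_continuous_zero_one_of_isClosed hfin₀.isClosed hfin₁.isClosed
    (by
      rw [Set.disjoint_left]
      rintro _ hb (⟨d, -, rfl⟩ | hb')
      · exact hb.2 ⟨d, rfl⟩
      · exact hb.2 hb'.2)
  -- A member of the dense sequence close to `v i * w` is close to `v i` on `e '' D` and small on
  -- all of `B`.
  let O : Set C(M, ℝ) :=
    (⋂ d ∈ e '' D, {f | |f d - v i d| < θ}) ∩ ⋂ b ∈ B, {f | |f b| < δ}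
  have hO : IsOpen O := by
    refine ((hD.image e).isOpen_biInter fun d _ => ?_).inter (hB.isOpen_biInter fun b _ => ?_)
    · exact isOpen_lt ((continuous_eval_const d).sub continuous_const).abs
        continuous_const
    · exact isOpen_lt (continuous_eval_const b).abs continuous_const
  have hne : O.Nonempty := by
    refine ⟨v i * w, mem_iInter₂.2 fun d hd => ?_, mem_iInter₂.2 fun b hb => ?_⟩
    · have : w d = 1 := hw1 (Or.inl hd)
      simpa [this] using hθ
    · by_cases hbe : b ∈ range e
      · have : w b = 1 := hw1 (Or.inr ⟨hb, hbe⟩)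
        simpa [this] using hi b hb hbe
      · have : w b = 0 := hw0 ⟨hb, hbe⟩
        simpa [this] using hδ
  obtain ⟨k, hk⟩ := hv.exists_mem_open hO hne
  have h1 := hDT (v k) fun d hd => mem_iInter₂.1 hk.1 (e d) (mem_image_of_mem e hd)
  have h2 := h k fun b hb => mem_iInter₂.1 hk.2 b hb
  rw [abs_sub_comm] at h1
  linarith [abs_sub_abs_le_abs_sub (T (v i) x) (T (v k) x)]

/-- The coordinates `min |T (v i) x| 1`, `i ∈ ℕ`, of `x` in the compact metrizable space
`ℕ → unitInterval`. -/
def truncatedCoords {X M : Type*} [TopologicalSpace M] (T : C(M, ℝ) → X → ℝ)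
    (v : ℕ → C(M, ℝ)) (x : X) : ℕ → unitInterval :=
  fun i => ⟨min |T (v i) x| 1, le_min (abs_nonneg _) zero_le_one, min_le_right _ _⟩

theorem continuous_truncatedCoords {X M : Type*} [TopologicalSpace X] [TopologicalSpace M]
    {T : C(M, ℝ) → X → ℝ} (hT : ∀ w, Continuous (T w)) (v : ℕ → C(M, ℝ)) :
    Continuous (truncatedCoords T v) :=
  continuous_pi fun i => ((hT (v i)).abs.min continuous_const).subtype_mk _

/-- The image of `X` in `ℕ → unitInterval` lies in a σ-compact set all of whose points have
finite control sets that avoid every `F m`. -/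
theorem IsSequentiallyDominated.exists_isSigmaCompact_control {X Y M : Type*} [TopologicalSpace X]
    (hX : IsSequentiallyDominated X) [TopologicalSpace M] [CompactSpace M] [T2Space M]
    {e : Y → M} {T : C(M, ℝ) → X → ℝ} (hTc : ∀ w, Continuous (T w))
    (hT : IsPointwiseContinuous e T) (hT0 : ∀ x, T 0 x = 0)
    {v : ℕ → C(M, ℝ)} (hv : DenseRange v) {F : ℕ → Set M} (hF : ∀ m, IsClosed (F m))
    (heF : ∀ y m, e y ∉ F m) {ε : ℝ} (hε : 0 < ε) (hε1 : ε < 1) :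
    ∃ S : Set (ℕ → unitInterval), IsSigmaCompact S ∧ (∀ x, truncatedCoords T v x ∈ S) ∧
      ∀ p ∈ S, ∃ B : Set M, B.Finite ∧ (∀ m, Disjoint B (F m)) ∧ ∃ δ > 0,
        ∀ i, (∀ b ∈ B, |v i b| < δ) → (p i : ℝ) ≤ ε := by
  -- `W l j` relates a point to its control sets with at most `j` points and tolerance
  -- `1 / (l + 1)`; `N l j` is the set of points that have such a control set.
  let W : ℕ → (j : ℕ) → Set ((ℕ → unitInterval) × (Fin j → M)) := fun l j =>
    {z | ∀ i, (∀ a, |v i (z.2 a)| < 1 / (l + 1 : ℝ)) → (z.1 i : ℝ) ≤ ε}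
  have hW : ∀ l j, IsClosed (W l j) := fun l j => by
    refine isClosed_setOf_forall_imp_le (Z := (ℕ → unitInterval) × (Fin j → M))
      (f := fun i a z => |v i (z.2 a)|) (g := fun i z => (z.1 i : ℝ)) ?_ ?_ _ _
    · fun_prop
    · fun_prop
  let N : ℕ → ℕ → Set (ℕ → unitInterval) := fun l j => Prod.fst '' W l j
  have hN : ∀ l j, IsClosed (N l j) := fun l j =>
    ((hW l j).isCompact.image continuous_fst).isClosed
  let D : ℕ → ℕ → Set (ℕ → unitInterval) := fun l j => ⋃ k ∈ Iio j, N l k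
  have hD : ∀ l j, IsClosed (D l j) := fun l j =>
    (finite_Iio j).isClosed_biUnion fun k _ => hN l k
  let E : ℕ → ℕ → ℕ → Set (ℕ → unitInterval) := fun l j m =>
    Prod.fst '' (W l j ∩ ⋃ a, {z | z.2 a ∈ F m})
  have hE : ∀ l j m, IsClosed (E l j m) := fun l j m => by
    refine (((hW l j).inter (isClosed_iUnion_of_finite fun a => ?_)).isCompact.image
      continuous_fst).isClosed
    exact (hF m).preimage ((continuous_apply a).comp continuous_snd)
  -- A control set of least size for a point of `X` lies in `range e`, so it avoids `F m`.
  have hdisj : ∀ l j x m, truncatedCoords T v x ∈ N l j → truncatedCoords T v x ∉ D l j →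
      truncatedCoords T v x ∉ E l j m := by
    rintro l j x m - hxD ⟨⟨_, B⟩, ⟨hBW, hBF⟩, rfl⟩
    obtain ⟨a₀, ha₀⟩ := mem_iUnion.1 hBF
    let J : Set (Fin j) := {a | B a ∈ range e}
    have hcard : Nat.card J < j := by
      have : J ⊂ univ := (ssubset_univ_iff).2 fun h => by
        obtain ⟨y, hy⟩ : a₀ ∈ J := h ▸ mem_univ a₀
        exact heF y m (hy.symm ▸ ha₀)
      simpa [Set.ncard_univ] using Set.ncard_lt_ncard this
    let s : Fin (Nat.card J) ≃ J := (Finite.equivFin J).symm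
    refine hxD (mem_biUnion (mem_Iio.2 hcard)
      ⟨(truncatedCoords T v x, fun a => B (s a)), fun i hi => ?_, rfl⟩)
    refine (min_le_left _ _).trans (hT.abs_le_of_control hv (finite_range B)
      (Nat.one_div_pos_of_nat (n := l)) (fun k hk => ?_) i ?_)
    · have h1 := hBW k fun a => hk _ (mem_range_self a)
      exact (min_le_iff.1 h1).resolve_right (not_le.2 hε1)
    · rintro _ ⟨a, rfl⟩ ha
      have h1 := hi (s.symm ⟨a, ha⟩)
      dsimp only at h1
      rwa [s.apply_symm_apply] at h1
  choose S hS hSN hSE hSx using fun l j =>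
    hX.exists_isSigmaCompact (continuous_truncatedCoords hTc v) (hN l j) (hD l j) (hE l j)
      (hdisj l j)
  refine ⟨⋃ l, ⋃ j, S l j, isSigmaCompact_iUnion _ fun l => isSigmaCompact_iUnion _ (hS l),
    fun x => ?_, fun p hp => ?_⟩
  · obtain ⟨A, hA, θ, hθ, hAT⟩ := hT x 0 ε hε
    obtain ⟨l, hl⟩ := exists_nat_one_div_lt hθ
    have hex : ∃ j, truncatedCoords T v x ∈ N l j := by
      have := hA.to_subtype
      let s : Fin (Nat.card A) ≃ A := (Finite.equivFin A).symm
      refine ⟨Nat.card A, (truncatedCoords T v x, fun a => e (s a)), fun i hi => ?_, rfl⟩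
      refine (min_le_left _ _).trans ?_
      have h1 := hAT (v i) fun d hd => by
        have h2 := hi (s.symm ⟨d, hd⟩)
        dsimp only at h2
        rw [s.apply_symm_apply] at h2
        simpa using h2.trans hl
      simpa [hT0] using h1.le
    classical
    refine mem_iUnion₂.2 ⟨l, Nat.find hex, hSx _ _ x (Nat.find_spec hex) fun h => ?_⟩
    obtain ⟨k, hk, hxk⟩ := mem_iUnion₂.1 h
    exact Nat.find_min hex hk hxk
  · obtain ⟨l, j, hpS⟩ := mem_iUnion₂.1 hp
    obtain ⟨⟨_, B⟩, hBW, rfl⟩ := hSN l j hpS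
    refine ⟨range B, finite_range B, fun m => Set.disjoint_left.2 ?_, _,
      Nat.one_div_pos_of_nat (n := l), fun i hi => hBW i fun a => hi _ (mem_range_self a)⟩
    rintro _ ⟨a, rfl⟩ ha
    exact Set.disjoint_left.1 (hSE l j m) hpS ⟨(_, B), ⟨hBW, mem_iUnion.2 ⟨a, ha⟩⟩, rfl⟩

/-- The transfer step: if `X` has dominated sequences and the values `w (e y)` are controlled by
the functions `T w` at finitely many points of `X`, then `range e` lies in a σ-compact set that
avoids every `F m`. -/
theorem IsSequentiallyDominated.exists_isSigmaCompact_range_subset {X Y M : Type*}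
    [TopologicalSpace X] (hX : IsSequentiallyDominated X) [TopologicalSpace M] [CompactSpace M]
    [TopologicalSpace.MetrizableSpace M] {e : Y → M} {T : C(M, ℝ) → X → ℝ}
    (hTc : ∀ w, Continuous (T w)) (hT : IsPointwiseContinuous e T) (hT0 : ∀ x, T 0 x = 0)
    (hTe : ∀ y, ∃ A : Set X, A.Finite ∧ ∃ ε > 0, ∀ w : C(M, ℝ),
      (∀ a ∈ A, |T w a| < ε) → |w (e y)| ≤ 1)
    {F : ℕ → Set M} (hF : ∀ m, IsClosed (F m)) (heF : ∀ y m, e y ∉ F m) :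
    ∃ Q, IsSigmaCompact Q ∧ range e ⊆ Q ∧ ∀ m, Disjoint Q (F m) := by
  let := TopologicalSpace.metrizableSpaceMetric M
  let v := TopologicalSpace.denseSeq C(M, ℝ)
  have hv : DenseRange v := TopologicalSpace.denseRange_denseSeq _
  -- Control sets for points of `X` use the tolerance `1 / (n + 2)`, strictly below the tolerance
  -- `1 / (n + 1)` used for points of `Y`.
  have hstep : ∀ n : ℕ, 1 / ((n + 1 : ℕ) + 1 : ℝ) < 1 / (n + 1 : ℝ) := fun n =>
    one_div_lt_one_div_of_lt (by positivity) (by push_cast; linarith)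
  have hle1 : ∀ n : ℕ, 1 / (n + 1 : ℝ) ≤ 1 := fun n =>
    (div_le_one (by positivity)).2 (by linarith [n.cast_nonneg (α := ℝ)])
  choose S hS hSx hSB using fun n : ℕ =>
    hX.exists_isSigmaCompact_control hTc hT hT0 hv hF heF
      (Nat.one_div_pos_of_nat (α := ℝ) (n := n + 1)) ((hstep n).trans_le (hle1 n))
  choose L hL hLS using hS
  let Z : ℕ → (k : ℕ) → Set ((Fin k → ℕ → unitInterval) × M) := fun n k =>
    {z | ∀ i, (∀ a, (z.1 a i : ℝ) < 1 / (n + 1 : ℝ)) → |v i z.2| ≤ 1}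
  have hZ : ∀ n k, IsClosed (Z n k) := fun n k => by
    refine isClosed_setOf_forall_imp_le (Z := (Fin k → ℕ → unitInterval) × M)
      (f := fun i a z => (z.1 a i : ℝ)) (g := fun i z => |v i z.2|) ?_ ?_ _ _
    · fun_prop
    · fun_prop
  let R : (n k : ℕ) → (Fin k → ℕ) → Set ((Fin k → ℕ → unitInterval) × M) := fun n k s =>
    Z n k ∩ (univ.pi fun a => L n (s a)) ×ˢ univ
  have hR : ∀ n k s, IsCompact (R n k s) := fun n k s =>
    ((isCompact_univ_pi fun a => hL n (s a)).prod isCompact_univ).inter_left (hZ n k)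
  refine ⟨⋃ n, ⋃ k, ⋃ s, Prod.snd '' R n k s, isSigmaCompact_iUnion _ fun n =>
    isSigmaCompact_iUnion _ fun k => isSigmaCompact_iUnion_of_isCompact _ fun s =>
    (hR n k s).image continuous_snd, ?_, fun m => Set.disjoint_left.2 fun q hq hqF => ?_⟩
  · rintro _ ⟨y, rfl⟩
    obtain ⟨A, hA, ε, hε, hAy⟩ := hTe y
    obtain ⟨n, hn⟩ := exists_nat_one_div_lt hε
    have := hA.to_subtype
    let t : Fin (Nat.card A) ≃ A := (Finite.equivFin A).symm
    have hs : ∀ a, ∃ s, truncatedCoords T v (t a : X) ∈ L n s := fun a =>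
      mem_iUnion.1 (hLS n ▸ hSx n _)
    choose s hs using hs
    refine mem_iUnion.2 ⟨n, mem_iUnion₂.2 ⟨_, s, (fun a => truncatedCoords T v (t a : X), e y),
      ⟨fun i hi => hAy (v i) fun a ha => ?_, fun a _ => hs a, mem_univ _⟩, rfl⟩⟩
    have h1 : min |T (v i) a| 1 < 1 / (n + 1 : ℝ) := by
      have h2 := hi (t.symm ⟨a, ha⟩)
      dsimp only at h2
      rwa [t.apply_symm_apply] at h2
    exact ((min_lt_iff.1 h1).resolve_right (not_lt.2 (hle1 n))).trans hn
  · obtain ⟨n, hq⟩ := mem_iUnion.1 hq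
    obtain ⟨k, s, ⟨A, q⟩, ⟨hAZ, hAL, -⟩, rfl⟩ := mem_iUnion₂.1 hq
    have hAS : ∀ a, A a ∈ S n := fun a => hLS n ▸ mem_iUnion.2 ⟨s a, hAL a (mem_univ a)⟩
    choose B hB hBF δ hδ hBδ using fun a => hSB n (A a) (hAS a)
    -- Otherwise `q` lies outside the finite set `⋃ a, B a`, and some `v i` is small on that set
    -- and larger than `1` at `q`.
    have hBq : Disjoint (⋃ a, B a) {q} := by
      rw [Set.disjoint_singleton_right]
      intro h
      obtain ⟨a, ha⟩ := mem_iUnion.1 h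
      exact Set.disjoint_left.1 (hBF a m) ha hqF
    obtain ⟨w, hw0, hw1, -⟩ := exists_continuous_zero_one_of_isClosed
      (finite_iUnion hB).isClosed isClosed_singleton hBq
    let O : Set C(M, ℝ) := {f | 1 < f q} ∩ ⋂ a, ⋂ b ∈ B a, {f | |f b| < δ a}
    have hO : IsOpen O := by
      refine (isOpen_lt continuous_const (continuous_eval_const q)).inter
        (isOpen_iInter_of_finite fun a => (hB a).isOpen_biInter fun b _ => ?_)
      exact isOpen_lt (continuous_eval_const b).abs continuous_const
    have hne : O.Nonempty := by
      refine ⟨w + w, ?_, mem_iInter.2 fun a => mem_iInter₂.2 fun b hb => ?_⟩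
      · have : w q = 1 := hw1 rfl
        simp [this]
      · have : w b = 0 := hw0 (mem_iUnion.2 ⟨a, hb⟩)
        simpa [this] using hδ a
    obtain ⟨i, hi⟩ := hv.exists_mem_open hO hne
    have h1 := hAZ i fun a => (hBδ a i fun b hb =>
      mem_iInter₂.1 (mem_iInter.1 hi.2 a) b hb).trans_lt (hstep n)
    exact absurd (hi.1.trans_le (le_abs_self _)) (not_lt.2 h1)

/-! ### Homeomorphisms of function spaces -/

theorem exists_finite_control_of_continuous {X : Type*} [TopologicalSpace X] {G : Cp X → ℝ}
    (hG : Continuous G) (g : Cp X) {η : ℝ} (hη : 0 < η) :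
    ∃ D : Set X, D.Finite ∧ ∃ θ > 0, ∀ g' : Cp X,
      (∀ d ∈ D, |g'.1 d - g.1 d| < θ) → |G g' - G g| < η := by
  have hU : IsOpen {g' : Cp X | |G g' - G g| < η} :=
    isOpen_lt (hG.sub continuous_const).abs continuous_const
  obtain ⟨V, hV, hVU⟩ := isOpen_induced_iff.1 hU
  have hgV : g ∈ Subtype.val ⁻¹' V := by
    rw [hVU]
    simpa using hη
  obtain ⟨I, u, hu, hIu⟩ := isOpen_pi_iff.1 hV g.1 hgV
  have hev : ∀ᶠ θ : ℝ in 𝓝[>] 0, ∀ d ∈ I, Metric.ball (g.1 d) θ ⊆ u d := by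
    refine (Finset.eventually_all _).2 fun d hd => ?_
    obtain ⟨r, hr, hru⟩ := Metric.isOpen_iff.1 (hu d hd).1 _ (hu d hd).2
    filter_upwards [Ioo_mem_nhdsGT hr] with θ hθ
    exact (Metric.ball_subset_ball hθ.2.le).trans hru
  obtain ⟨θ, hθ, hθ0⟩ := (hev.and self_mem_nhdsWithin).exists
  refine ⟨I, I.finite_toSet, θ, hθ0, fun g' hg' => ?_⟩
  have : g' ∈ Subtype.val ⁻¹' V := hIu fun d hd => hθ d hd (hg' d hd)
  rwa [hVU] at this

theorem IsSequentiallyDominated.of_homeomorph_Cp {X : Type u} {Y : Type v} [TopologicalSpace X]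
    [TopologicalSpace Y] (hX : IsSequentiallyDominated X) (φ : Cp X ≃ₜ Cp Y) :
    IsSequentiallyDominated Y := by
  intro f hf
  let e : Y → ℕ → unitInterval := fun y m =>
    ⟨(1 + |f m y|)⁻¹, by positivity, inv_le_one_of_one_le₀ (by linarith [abs_nonneg (f m y)])⟩
  have he : Continuous e := continuous_pi fun m => Continuous.subtype_mk
    ((continuous_const.add (hf m).abs).inv₀ fun y => (by positivity : (0 : ℝ) < 1 + |f m y|).ne') _
  let c : C(ℕ → unitInterval, ℝ) → Cp Y := fun w => ⟨fun y => w (e y), w.continuous.comp he⟩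
  let T : C(ℕ → unitInterval, ℝ) → X → ℝ := fun w x => (φ.symm (c w)).1 x - (φ.symm (c 0)).1 x
  have heval : ∀ {Z : Type _} [TopologicalSpace Z] (z : Z), Continuous fun g : Cp Z => g.1 z :=
    fun z => (continuous_apply z).comp continuous_subtype_val
  obtain ⟨Q, ⟨K, hK, rfl⟩, heQ, hQ⟩ := hX.exists_isSigmaCompact_range_subset (e := e) (T := T)
    (F := fun m => {q | (q m : ℝ) = 0})
    (fun w => (φ.symm (c w)).2.sub (φ.symm (c 0)).2)
    (fun x w η hη => by
      obtain ⟨D, hD, θ, hθ, h⟩ := exists_finite_control_of_continuous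
        ((heval x).comp φ.symm.continuous) (c w) hη
      refine ⟨D, hD, θ, hθ, fun w' hw' => ?_⟩
      have := h (c w') hw'
      simpa [T] using this)
    (fun x => sub_self _)
    (fun y => by
      have hcont : Continuous fun g : Cp X => (φ g).1 y :=
        ((continuous_apply y).comp continuous_subtype_val).comp φ.continuous
      obtain ⟨A, hA, ε, hε, h⟩ := exists_finite_control_of_continuous hcont
        (φ.symm (c 0)) one_pos
      refine ⟨A, hA, ε, hε, fun w hw => ?_⟩
      have := h (φ.symm (c w)) hw
      simpa [c] using this.le)
    (fun m => isClosed_eq (by fun_prop) continuous_const)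
    (fun y m h => by
      have h' : (1 + |f m y|)⁻¹ = 0 := h
      have : (0 : ℝ) < (1 + |f m y|)⁻¹ := by positivity
      exact this.ne' h')
  have hbound : ∀ s m, ∃ b : ℝ, ∀ q ∈ K s, (q m : ℝ)⁻¹ ≤ b := by
    intro s m
    have hcont : ContinuousOn (fun q : ℕ → unitInterval => (q m : ℝ)⁻¹) (K s) :=
      ContinuousOn.inv₀ (by fun_prop) fun q hq h0 =>
        Set.disjoint_left.1 (hQ m) (mem_iUnion.2 ⟨s, hq⟩) h0
    obtain ⟨b, hb⟩ := (hK s).bddAbove_image hcont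
    exact ⟨b, fun q hq => hb ⟨q, hq, rfl⟩⟩
  choose b hb using hbound
  -- Diagonalization: this sequence dominates each of the sequences `b s`, from the index `s` on.
  refine ⟨fun m => ∑ s ∈ Finset.range (m + 1), |b s m|, fun y => ?_⟩
  obtain ⟨s, hs⟩ := mem_iUnion.1 (heQ ⟨y, rfl⟩)
  filter_upwards [eventually_ge_atTop s] with m hm
  have h1 : ((1 + |f m y|)⁻¹)⁻¹ ≤ b s m := hb s m _ hs
  rw [inv_inv] at h1
  calc |f m y| ≤ |b s m| := by linarith [le_abs_self (b s m)]
    _ ≤ ∑ s ∈ Finset.range (m + 1), |b s m| :=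
      Finset.single_le_sum (f := fun s => |b s m|) (fun _ _ => abs_nonneg _)
        (Finset.mem_range.2 (by omega))

theorem mainTheorem2 (X : Type u) (Y : Type v)
    [TopologicalSpace X] [T35Space X] [TopologicalSpace Y] [T35Space Y]
    (h : Nonempty (Cp X ≃ₜ Cp Y)) :
    IsProjectivelyHurewicz X ↔ IsProjectivelyHurewicz Y := by
  obtain ⟨φ⟩ := h
  simp only [isProjectivelyHurewicz_iff_isSequentiallyDominated]
  exact ⟨fun hX => hX.of_homeomorph_Cp φ, fun hY => hY.of_homeomorph_Cp φ.symm⟩
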